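/- Let $\Omega\subset\mathbb R^2$ be a smooth bounded simply connected domain, let $n\ge 2$, and let $g_1,\dots,g_n:\partial\Omega\to S^1=\{z\in\mathbb C:|z|=1\}$ be smooth maps of degrees $d_j=\deg(g_j,\partial\Omega)$ with $d_j\ge 0$ for all $1\le j\le n$. For each $j$ let $H^1_{g_j}(\Omega;\mathbb C)=\{u\in H^1(\Omega;\mathbb C): u=g_j\text{ on }\partial\Omega\}$, the boundary condition being understood in the sense of traces, and let $$\mathcal X(g_1,\dots,g_n)=\Big\{(u_1,\dots,u_n)\in H^1_{g_1}(\Omega;\mathbb C)\times\cdots\times H^1_{g_n}(\Omega;\mathbb C):\ \sum_{j=1}^n|u_j|^2=n\ \text{ a.e. on }\Omega\Big\}.$$ Then $\mathcal X(g_1,\dots,g_n)\neq\emptyset$. Furthermore, with $$I(u_1,\dots,u_n)=\sum_{j=1}^n\int_\Omega|\nabla u_j|^2\,dx,$$ the infimum $$\beta(g_1,\dots,g_n)=\inf\big\{I(u_1,\dots,u_n):(u_1,\dots,u_n)\in\mathcal X(g_1,\dots,g_n)\big\}$$ is attained by some element of $\mathcal X(g_1,\dots,g_n)$. -/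

import Mathlib

open MeasureTheory Filter Topology
open scoped ContDiff

noncomputable section

/-- The Euclidean plane. -/
abbrev Plane : Type := EuclideanSpace ℝ (Fin 2)

/-- The standard basis vector `e_i` of the plane. -/
def stdVec (i : Fin 2) : Plane := EuclideanSpace.single i 1

/-- Counterclockwise rotation by a right angle. -/
def rotLeft (v : Plane) : Plane := !₂[-(v 1), v 0]

/-- `Ω` has a smooth boundary: near every boundary point, `Ω` is the set where a smooth
function with nonvanishing differential is negative. -/
def HasSmoothBoundary (Ω : Set Plane) : Prop :=
  ∀ p ∈ frontier Ω, ∃ U : Set Plane, IsOpen U ∧ p ∈ U ∧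
    ∃ ρ : Plane → ℝ, ContDiffOn ℝ ∞ ρ U ∧ (∀ x ∈ U, fderiv ℝ ρ x ≠ 0) ∧
      Ω ∩ U = {x ∈ U | ρ x < 0}

/-- A smooth bounded simply connected domain in the plane. (`SimplyConnectedSpace` contains
path connectedness and nonemptiness.) -/
structure IsSmoothSimplyConnectedDomain (Ω : Set Plane) : Prop where
  isOpen : IsOpen Ω
  bounded : Bornology.IsBounded Ω
  simplyConnected : SimplyConnectedSpace Ω
  smoothBoundary : HasSmoothBoundary Ω

/-- Smoothness of a map `g : ∂Ω → S¹`: near every point of `∂Ω` it is the restriction of a smooth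
map defined on an open subset of the plane. -/
def IsSmoothBoundaryMap {Ω : Set Plane} (g : frontier Ω → Circle) : Prop :=
  ∀ p : frontier Ω, ∃ U : Set Plane, IsOpen U ∧ (p : Plane) ∈ U ∧
    ∃ G : Plane → ℂ, ContDiffOn ℝ ∞ G U ∧ ∀ q : frontier Ω, (q : Plane) ∈ U → G q = (g q : ℂ)

/-- `γ` is a regular smooth 1-periodic simple parametrization of the closed curve `∂Ω`, positively
oriented, i.e. with `Ω` lying on its left. -/
structure IsPositiveBoundaryParam (Ω : Set Plane) (γ : ℝ → Plane) : Prop where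
  smooth : ContDiff ℝ ∞ γ
  periodic : Function.Periodic γ 1
  injOn : Set.InjOn γ (Set.Ico 0 1)
  regular : ∀ t, deriv γ t ≠ 0
  range_eq : Set.range γ = frontier Ω
  left : ∀ t, ∀ᶠ s : ℝ in 𝓝[>] 0, γ t + s • rotLeft (deriv γ t) ∈ Ω

/-- `deg (g, ∂Ω) = d`: along a positively oriented parametrization of `∂Ω`, a continuous choice of
the argument of `g` increases by `2 π d`. -/
def HasBoundaryDegree {Ω : Set Plane} (g : frontier Ω → Circle) (d : ℤ) : Prop :=
  ∃ γ : ℝ → Plane, IsPositiveBoundaryParam Ω γ ∧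
    ∃ θ : ℝ → ℝ, Continuous θ ∧
      (∀ (t : ℝ) (ht : γ t ∈ frontier Ω), g ⟨γ t, ht⟩ = Circle.exp (θ t)) ∧
      θ 1 - θ 0 = 2 * Real.pi * d

/-- `v` is a weak (distributional) `i`-th partial derivative of `u` on `Ω`. -/
def IsWeakPartial (Ω : Set Plane) (i : Fin 2) (u v : Plane → ℂ) : Prop :=
  LocallyIntegrableOn u Ω ∧ LocallyIntegrableOn v Ω ∧
    ∀ φ : Plane → ℝ, ContDiff ℝ ∞ φ → HasCompactSupport φ → tsupport φ ⊆ Ω →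
      ∫ x in Ω, fderiv ℝ φ x (stdVec i) • u x = - ∫ x in Ω, φ x • v x

/-- Weak partial derivatives are unique up to null sets. -/
theorem IsWeakPartial.ae_eq {Ω : Set Plane} (hΩ : IsOpen Ω) {i : Fin 2} {u v w : Plane → ℂ}
    (hv : IsWeakPartial Ω i u v) (hw : IsWeakPartial Ω i u w) :
    v =ᵐ[volume.restrict Ω] w := by
  have hint : ∀ f : Plane → ℂ, LocallyIntegrableOn f Ω → ∀ φ : Plane → ℝ, ContDiff ℝ ∞ φ →
      HasCompactSupport φ → tsupport φ ⊆ Ω → Integrable (fun x => φ x • f x) := by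
    intro f hf φ h1 h2 h3
    have hK : IntegrableOn f (tsupport φ) := hf.integrableOn_compact_subset h3 h2
    have h4 : IntegrableOn (fun x => φ x • f x) (tsupport φ) :=
      hK.continuousOn_smul h1.continuous.continuousOn h2
    refine (integrableOn_iff_integrable_of_support_subset ?_).1 h4
    intro x hx
    refine subset_tsupport φ ?_
    intro h0
    exact hx (by simp [h0])
  have key := hΩ.ae_eq_zero_of_integral_contDiff_smul_eq_zero (μ := volume)
    (f := fun x => v x - w x) (hv.2.1.sub hw.2.1) (by
      intro φ h1 h2 h3
      have e : ∫ x in Ω, φ x • v x = ∫ x in Ω, φ x • w x :=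
        neg_injective ((hv.2.2 φ h1 h2 h3).symm.trans (hw.2.2 φ h1 h2 h3))
      have hz : ∀ f : Plane → ℂ, ∫ x in Ω, φ x • f x = ∫ x, φ x • f x := by
        intro f
        refine setIntegral_eq_integral_of_forall_compl_eq_zero ?_
        intro x hx
        have : φ x = 0 := image_eq_zero_of_notMem_tsupport (fun h => hx (h3 h))
        simp [this]
      rw [hz, hz] at e
      simp only [smul_sub]
      rw [integral_sub (hint v hv.2.1 φ h1 h2 h3) (hint w hw.2.1 φ h1 h2 h3), e, sub_self])
  rw [Filter.EventuallyEq, ae_restrict_iff' hΩ.measurableSet]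
  filter_upwards [key] with x hx hxΩ
  exact sub_eq_zero.1 (hx hxΩ)

open Classical in
/-- The weak `i`-th partial derivative of `u` on `Ω` (`0` if there is none). -/
def weakPartial (Ω : Set Plane) (i : Fin 2) (u : Plane → ℂ) : Plane → ℂ :=
  if h : ∃ v, IsWeakPartial Ω i u v then h.choose else 0

/-- `u ∈ H¹(Ω; ℂ)`. Functions are considered on `Ω` only. -/
def MemH1 (Ω : Set Plane) (u : Plane → ℂ) : Prop :=
  MemLp u 2 (volume.restrict Ω) ∧
    ∀ i, ∃ v, IsWeakPartial Ω i u v ∧ MemLp v 2 (volume.restrict Ω)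

/-- `u = g` on `∂Ω` in the sense of traces: `(u, g)` is the limit in `H¹(Ω) × L²(∂Ω)` of pairs
`(φ_k, φ_k|∂Ω)` with `φ_k` smooth up to the boundary; `L²(∂Ω)` refers to arc length, that is,
one-dimensional Hausdorff measure. -/
def HasTrace {Ω : Set Plane} (u : Plane → ℂ) (g : frontier Ω → Circle) : Prop :=
  ∃ φ : ℕ → Plane → ℂ, (∀ k, ContDiff ℝ ∞ (φ k)) ∧
    Tendsto (fun k => eLpNorm (fun x => φ k x - u x) 2 (volume.restrict Ω)) atTop (𝓝 0) ∧
    (∀ i, Tendsto (fun k => eLpNorm (fun x => fderiv ℝ (φ k) x (stdVec i) - weakPartial Ω i u x) 2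
      (volume.restrict Ω)) atTop (𝓝 0)) ∧
    Tendsto (fun k => eLpNorm (fun x : frontier Ω => φ k x - (g x : ℂ)) 2
      (Measure.hausdorffMeasure 1 : Measure (frontier Ω))) atTop (𝓝 0)

/-- `H¹_g(Ω; ℂ)`. -/
def H1WithBoundary {Ω : Set Plane} (g : frontier Ω → Circle) : Set (Plane → ℂ) :=
  {u | MemH1 Ω u ∧ HasTrace u g}

/-- The class `X(g_1, …, g_n; Ω)`. -/
def constraintClass {n : ℕ} {Ω : Set Plane} (g : Fin n → frontier Ω → Circle) :
    Set (Fin n → Plane → ℂ) :=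
  {u | (∀ j, u j ∈ H1WithBoundary (g j)) ∧
    ∀ᵐ x ∂(volume.restrict Ω), ∑ j, ‖u j x‖ ^ 2 = (n : ℝ)}

/-- `I(u_1, …, u_n) = ∑_j ∫_Ω |∇ u_j|²`. -/
def dirichletEnergy {n : ℕ} (Ω : Set Plane) (u : Fin n → Plane → ℂ) : ℝ :=
  ∑ j, ∫ x in Ω, ∑ i, ‖weakPartial Ω i (u j) x‖ ^ 2

/-- `β(g_1, …, g_n)`, the infimum of `I` over `X(g_1, …, g_n)`. -/
def minEnergy {n : ℕ} {Ω : Set Plane} (g : Fin n → frontier Ω → Circle) : ℝ :=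
  sInf (dirichletEnergy Ω '' constraintClass g)

end

/-!
The constraint class is nonempty because its members take values in a sphere of dimension
`2n - 1 ≥ 3`, which is simply connected, so that boundary data of any degrees extend to it.
Let `G` be a smooth extension of `(g_1, …, g_n)` to the plane. The cone `{t G(x)}` is a smooth image of a space of dimension `3`
in `ℂⁿ`, so some vector `a` is not in it. Then `G - (n - |G|²) a` has no zeros and equals `G` on
`∂Ω`, where `|G|² = n`. Normalizing it gives a smooth map of the plane with values in the sphere of
radius `√n` and the right boundary values (`exists_contDiff_norm_sq_eq`,
`constraintClass_nonempty`). Being smooth on the whole plane, it serves as its own approximating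
sequence in the definition of the trace.

The infimum is attained by the direct method (`exists_dirichletEnergy_le_minEnergy`). A minimizing
sequence is bounded in `L²` by the constraint, so the triples formed by its components and their
partial derivatives converge weakly in `L²` along a subsequence (`exists_weakTendsto_subseq`). Three
properties pass to the weak limit.

* The energy does not increase, since the norm is weakly lower semicontinuous.
* The limit lies in `H¹` and has the right trace. Having a trace `g` means that for every `ε > 0` the
  triple belongs to the closure of the convex set of the triples of smooth functions within `ε` of
  `g` in `L²(∂Ω)`, and by Mazur's theorem such closures are weakly closed
  (`WeakTendsto.mem_closure_of_convex`, `mem_H1WithBoundary_of_mem_closure`).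
* The constraint `∑ |u_j|² = n` survives because the convergence is strong in `L²` of small balls
  (`tendsto_eLpNorm_ball_of_weakTendsto`). This local form of Rellich's theorem is proved on smooth
  functions `w`: the `L²` distance of `w` from its mean values over discs of radius `s` is at most
  `s ‖∇w‖`, and for fixed `s` the mean values converge boundedly
  (`tendsto_lintegral_ball_enorm_sq`).
-/

/-! ### Weak sequential convergence -/

/-- Weak convergence of a sequence in a real normed space: convergence against every continuous
linear functional. -/
def WeakTendsto {E : Type*} [NormedAddCommGroup E] [NormedSpace ℝ E] (x : ℕ → E) (y : E) : Prop :=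
  ∀ f : E →L[ℝ] ℝ, Tendsto (fun m => f (x m)) atTop (𝓝 (f y))

section WeakConvergence

variable {E F : Type*} [NormedAddCommGroup E] [NormedSpace ℝ E] [NormedAddCommGroup F]
  [NormedSpace ℝ F]

theorem WeakTendsto.map {x : ℕ → E} {y : E} (h : WeakTendsto x y) (L : E →L[ℝ] F) :
    WeakTendsto (fun m => L (x m)) (L y) :=
  fun f => h (f.comp L)

theorem Filter.Tendsto.weakTendsto {x : ℕ → E} {y : E} (h : Tendsto x atTop (𝓝 y)) :
    WeakTendsto x y :=
  fun f => (f.continuous.tendsto y).comp h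

theorem WeakTendsto.sub {x x' : ℕ → E} {y y' : E} (h : WeakTendsto x y) (h' : WeakTendsto x' y') :
    WeakTendsto (fun m => x m - x' m) (y - y') := by
  intro f
  simpa using (h f).sub (h' f)

theorem WeakTendsto.tendsto_complex {x : ℕ → ℂ} {y : ℂ} (h : WeakTendsto x y) :
    Tendsto x atTop (𝓝 y) := by
  have h1 := (Complex.continuous_ofReal.tendsto _).comp (h Complex.reCLM)
  have h2 := (Complex.continuous_ofReal.tendsto _).comp (h Complex.imCLM)
  have := h1.add (h2.mul_const Complex.I)
  simpa [Function.comp_def, Complex.re_add_im] using this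

/-- Mazur's theorem: the closure of a convex set contains the weak limits of its sequences. -/
theorem WeakTendsto.mem_closure_of_convex {x : ℕ → E} {y : E} (h : WeakTendsto x y) {C : Set E}
    (hC : Convex ℝ C) (hx : ∀ᶠ m in atTop, x m ∈ C) : y ∈ closure C := by
  by_contra hy
  obtain ⟨f, c, hc, hcy⟩ := geometric_hahn_banach_closed_point hC.closure isClosed_closure hy
  obtain ⟨m, hm1, hm2⟩ := (((h f).eventually (lt_mem_nhds hcy)).and hx).exists
  exact lt_asymm hm1 (hc _ (subset_closure hm2))

theorem WeakTendsto.norm_le {x : ℕ → E} {y : E} (h : WeakTendsto x y) {r : ℝ}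
    (hx : ∀ᶠ m in atTop, ‖x m‖ ≤ r) : ‖y‖ ≤ r := by
  have := h.mem_closure_of_convex (convex_closedBall (0 : E) r)
    (by simpa [Metric.mem_closedBall, dist_zero_right] using hx)
  rwa [Metric.isClosed_closedBall.closure_eq, mem_closedBall_zero_iff] at this

/-- The norm is weakly sequentially lower semicontinuous. -/
theorem WeakTendsto.norm_le_of_tendsto {x : ℕ → E} {y : E} (h : WeakTendsto x y) {r : ℝ}
    (hx : Tendsto (fun m => ‖x m‖) atTop (𝓝 r)) : ‖y‖ ≤ r := by
  refine le_of_forall_gt_imp_ge_of_dense fun s hs => ?_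
  exact h.norm_le ((hx.eventually (gt_mem_nhds hs)).mono fun m hm => hm.le)

/-- Bounded sequences of a separable Hilbert space have weakly convergent subsequences. -/
theorem exists_weakTendsto_subseq {H : Type*} [NormedAddCommGroup H] [InnerProductSpace ℝ H]
    [CompleteSpace H] [TopologicalSpace.SeparableSpace H] {x : ℕ → H} {r : ℝ}
    (hx : ∀ m, ‖x m‖ ≤ r) : ∃ (y : H) (σ : ℕ → ℕ), StrictMono σ ∧ WeakTendsto (x ∘ σ) y := by
  obtain ⟨l, -, σ, hσ, hl⟩ := WeakDual.isSeqCompact_closedBall ℝ H 0 r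
    (x := fun m => StrongDual.toWeakDual (InnerProductSpace.toDual ℝ H (x m)))
    (fun m => by
      simp only [Set.mem_preimage, mem_closedBall_zero_iff]
      exact ((InnerProductSpace.toDual ℝ H).norm_map (x m)).le.trans (hx m))
  refine ⟨(InnerProductSpace.toDual ℝ H).symm (WeakDual.toStrongDual l), σ, hσ, fun f => ?_⟩
  have h := ((WeakDual.eval_continuous ((InnerProductSpace.toDual ℝ H).symm f)).tendsto l).comp hl
  have e : ∀ z : H, f z = inner ℝ z ((InnerProductSpace.toDual ℝ H).symm f) := fun z => by
    rw [real_inner_comm, InnerProductSpace.toDual_symm_apply]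
  rw [e, InnerProductSpace.toDual_symm_apply]
  refine h.congr fun m => ?_
  simp only [Function.comp_apply]
  rw [e]
  rfl

end WeakConvergence

/-! ### Local compactness in `L²` of sequences bounded in `H¹` -/

/-- The square `|∇w|²` of the length of the gradient, as an extended nonnegative real. -/
noncomputable def gradSq (w : Plane → ℂ) (x : Plane) : ENNReal :=
  ∑ i, ‖fderiv ℝ w x (stdVec i)‖ₑ ^ 2

theorem continuous_fderiv_stdVec {w : Plane → ℂ} (hw : ContDiff ℝ ∞ w) (i : Fin 2) :
    Continuous fun x => fderiv ℝ w x (stdVec i) :=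
  (hw.continuous_fderiv (by simp)).clm_apply continuous_const

theorem continuous_gradSq {w : Plane → ℂ} (hw : ContDiff ℝ ∞ w) : Continuous (gradSq w) :=
  continuous_finsetSum _ fun i _ =>
    (ENNReal.continuous_pow 2).comp (continuous_fderiv_stdVec hw i).enorm

theorem eq_sum_stdVec (h : Plane) : h = h 0 • stdVec 0 + h 1 • stdVec 1 := by
  ext i
  fin_cases i <;> simp [stdVec]

theorem enorm_fderiv_apply_sq_le (w : Plane → ℂ) (x h : Plane) :
    ‖fderiv ℝ w x h‖ₑ ^ 2 ≤ ‖h‖ₑ ^ 2 * gradSq w x := by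
  have e : gradSq w x = ENNReal.ofReal (∑ i, ‖fderiv ℝ w x (stdVec i)‖ ^ 2) := by
    rw [ENNReal.ofReal_sum_of_nonneg (fun _ _ => by positivity)]
    refine Finset.sum_congr rfl fun i _ => ?_
    rw [ENNReal.ofReal_pow (norm_nonneg _), ofReal_norm]
  rw [e, ← ofReal_norm, ← ofReal_norm, ← ENNReal.ofReal_pow (norm_nonneg _),
    ← ENNReal.ofReal_pow (norm_nonneg _), ← ENNReal.ofReal_mul (by positivity)]
  refine ENNReal.ofReal_le_ofReal ?_
  have h1 : ‖fderiv ℝ w x h‖ ≤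
      |h 0| * ‖fderiv ℝ w x (stdVec 0)‖ + |h 1| * ‖fderiv ℝ w x (stdVec 1)‖ := by
    conv_lhs => rw [eq_sum_stdVec h]
    rw [map_add, map_smul, map_smul]
    refine (norm_add_le _ _).trans ?_
    rw [norm_smul, norm_smul, Real.norm_eq_abs, Real.norm_eq_abs]
  have h2 : ‖h‖ ^ 2 = |h 0| ^ 2 + |h 1| ^ 2 := by
    rw [EuclideanSpace.norm_sq_eq, Fin.sum_univ_two, Real.norm_eq_abs, Real.norm_eq_abs]
  rw [h2, Fin.sum_univ_two]
  refine (pow_le_pow_left₀ (norm_nonneg _) h1 2).trans ?_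
  nlinarith [sq_nonneg (|h 0| * ‖fderiv ℝ w x (stdVec 1)‖ - |h 1| * ‖fderiv ℝ w x (stdVec 0)‖)]

/-- The Cauchy–Schwarz inequality against the constant function `1`. -/
theorem sq_lintegral_le {α : Type*} [MeasurableSpace α] (μ : Measure α) {f : α → ENNReal}
    (hf : AEMeasurable f μ) : (∫⁻ x, f x ∂μ) ^ 2 ≤ μ Set.univ * ∫⁻ x, f x ^ 2 ∂μ := by
  have h := ENNReal.lintegral_mul_le_Lp_mul_Lq μ (p := 2) (q := 2)
    Real.HolderConjugate.two_two (f := f) (g := fun _ => 1) hf aemeasurable_const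
  simp only [Pi.mul_apply, mul_one, ENNReal.one_rpow, lintegral_const, one_mul] at h
  calc (∫⁻ x, f x ∂μ) ^ 2
      ≤ ((∫⁻ x, f x ^ (2 : ℝ) ∂μ) ^ (1 / 2 : ℝ) * μ Set.univ ^ (1 / 2 : ℝ)) ^ 2 := by gcongr
    _ = μ Set.univ * ∫⁻ x, f x ^ 2 ∂μ := by
      rw [mul_pow, ← ENNReal.rpow_natCast, ← ENNReal.rpow_natCast, ← ENNReal.rpow_mul,
        ← ENNReal.rpow_mul]
      simp [mul_comm]

theorem enorm_sub_sq_le {w : Plane → ℂ} (hw : ContDiff ℝ ∞ w) (x h : Plane) :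
    ‖w (x + h) - w x‖ₑ ^ 2 ≤ ‖h‖ₑ ^ 2 * ∫⁻ t in Set.Ioc (0 : ℝ) 1, gradSq w (x + t • h) := by
  have hline : Continuous fun t : ℝ => x + t • h := by fun_prop
  have hc : Continuous fun t : ℝ => fderiv ℝ w (x + t • h) h :=
    ((hw.continuous_fderiv (by simp)).comp hline).clm_apply continuous_const
  have hderiv : ∀ t ∈ Set.uIcc (0 : ℝ) 1,
      HasDerivAt (fun t : ℝ => w (x + t • h)) (fderiv ℝ w (x + t • h) h) t := by
    intro t _
    have h1 : HasDerivAt (fun t : ℝ => x + t • h) h t := by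
      simpa using ((hasDerivAt_id t).smul_const h).const_add x
    exact ((hw.differentiable (by simp)).differentiableAt.hasFDerivAt).comp_hasDerivAt t h1
  have hftc := intervalIntegral.integral_eq_sub_of_hasDerivAt hderiv (hc.intervalIntegrable 0 1)
  simp only [one_smul, zero_smul, add_zero] at hftc
  rw [← hftc, intervalIntegral.integral_of_le zero_le_one]
  calc ‖∫ t in Set.Ioc (0 : ℝ) 1, fderiv ℝ w (x + t • h) h‖ₑ ^ 2
      ≤ (∫⁻ t in Set.Ioc (0 : ℝ) 1, ‖fderiv ℝ w (x + t • h) h‖ₑ) ^ 2 := by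
        gcongr
        exact enorm_integral_le_lintegral_enorm _
    _ ≤ ∫⁻ t in Set.Ioc (0 : ℝ) 1, ‖fderiv ℝ w (x + t • h) h‖ₑ ^ 2 := by
        refine (sq_lintegral_le _ hc.enorm.measurable.aemeasurable).trans ?_
        simp
    _ ≤ ∫⁻ t in Set.Ioc (0 : ℝ) 1, ‖h‖ₑ ^ 2 * gradSq w (x + t • h) :=
        lintegral_mono fun t => enorm_fderiv_apply_sq_le w _ h
    _ = _ := lintegral_const_mul _ ((continuous_gradSq hw).comp hline).measurable

/-- Translating a smooth function by `h` changes it in `L²` by at most `|h|` times the `L²` norm of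
its gradient. -/
theorem lintegral_enorm_translate_sub_sq_le {Ω : Set Plane} (hΩ : MeasurableSet Ω)
    {w : Plane → ℂ} (hw : ContDiff ℝ ∞ w) {x₀ h : Plane} {r s : ℝ}
    (hball : Metric.ball x₀ (r + s) ⊆ Ω) (hh : ‖h‖ ≤ s) :
    ∫⁻ x in Metric.ball x₀ r, ‖w (x + h) - w x‖ₑ ^ 2 ≤ ‖h‖ₑ ^ 2 * ∫⁻ x in Ω, gradSq w x := by
  have hcont := continuous_gradSq hw
  calc ∫⁻ x in Metric.ball x₀ r, ‖w (x + h) - w x‖ₑ ^ 2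
      ≤ ∫⁻ x in Metric.ball x₀ r,
          ‖h‖ₑ ^ 2 * ∫⁻ t in Set.Ioc (0 : ℝ) 1, gradSq w (x + t • h) :=
        lintegral_mono fun x => enorm_sub_sq_le hw x h
    _ = ‖h‖ₑ ^ 2 * ∫⁻ x in Metric.ball x₀ r, ∫⁻ t in Set.Ioc (0 : ℝ) 1, gradSq w (x + t • h) := by
        refine lintegral_const_mul' _ _ (by simp)
    _ = ‖h‖ₑ ^ 2 * ∫⁻ t in Set.Ioc (0 : ℝ) 1, ∫⁻ x in Metric.ball x₀ r, gradSq w (x + t • h) := by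
        congr 1
        refine lintegral_lintegral_swap (Measurable.aemeasurable ?_)
        refine (hcont.comp (f := fun p : Plane × ℝ => p.1 + p.2 • h) (by fun_prop)).measurable
    _ ≤ ‖h‖ₑ ^ 2 * ∫⁻ t in Set.Ioc (0 : ℝ) 1, ∫⁻ x in Ω, gradSq w x := by
        gcongr ‖h‖ₑ ^ 2 * ?_
        refine setLIntegral_mono measurable_const fun t ht => ?_
        rw [← lintegral_indicator hΩ, ← lintegral_indicator measurableSet_ball,
          ← lintegral_add_right_eq_self (μ := volume) (Ω.indicator (gradSq w)) (t • h)]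
        refine lintegral_mono fun x => ?_
        by_cases hx : x ∈ Metric.ball x₀ r
        · have : x + t • h ∈ Ω := by
            refine hball ?_
            rw [Metric.mem_ball, dist_eq_norm] at hx ⊢
            have h1 : ‖t • h‖ ≤ s := by
              rw [norm_smul, Real.norm_of_nonneg ht.1.le]
              exact (mul_le_of_le_one_left (norm_nonneg _) ht.2).trans hh
            calc ‖x + t • h - x₀‖ = ‖(x - x₀) + t • h‖ := by congr 1; abel
              _ ≤ _ := norm_add_le _ _
              _ < r + s := by linarith
          simp [hx, this]
        · simp [hx]
    _ = _ := by simp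

/-- A smooth function is controlled in `L²` of a ball by its gradient and its averages over
small balls. -/
theorem lintegral_enorm_sq_le_gradSq_add_average {Ω : Set Plane} (hΩ : MeasurableSet Ω)
    {w : Plane → ℂ} (hw : ContDiff ℝ ∞ w) {x₀ : Plane} {r s : ℝ}
    (hball : Metric.ball x₀ (r + s) ⊆ Ω) :
    volume (Metric.ball (0 : Plane) s) ^ 2 * ∫⁻ x in Metric.ball x₀ r, ‖w x‖ₑ ^ 2 ≤
      2 * (volume (Metric.ball (0 : Plane) s) ^ 2 * (ENNReal.ofReal s ^ 2 * ∫⁻ x in Ω, gradSq w x))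
      + 2 * ∫⁻ x in Metric.ball x₀ r, ‖∫ h in Metric.ball (0 : Plane) s, w (x + h)‖ₑ ^ 2 := by
  set V := volume (Metric.ball (0 : Plane) s) with hV
  have hVtop : V ≠ ⊤ := measure_ball_lt_top.ne
  have hint : ∀ f : Plane → ℂ, Continuous f → IntegrableOn f (Metric.ball (0 : Plane) s) :=
    fun f hf => (hf.continuousOn.integrableOn_compact (isCompact_closedBall _ _)).mono_set
      Metric.ball_subset_closedBall
  have hjoint : Continuous fun p : Plane × Plane => ‖w (p.1 + p.2) - w p.1‖ₑ ^ 2 := by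
    have := hw.continuous
    refine (ENNReal.continuous_pow 2).comp (Continuous.enorm ?_)
    fun_prop
  have hpt : ∀ x, V ^ 2 * ‖w x‖ₑ ^ 2 ≤
      2 * (V * ∫⁻ h in Metric.ball (0 : Plane) s, ‖w (x + h) - w x‖ₑ ^ 2)
      + 2 * ‖∫ h in Metric.ball (0 : Plane) s, w (x + h)‖ₑ ^ 2 := by
    intro x
    have hwx : Continuous fun h => w (x + h) := hw.continuous.comp (by fun_prop)
    have h1 : V * ‖w x‖ₑ = ‖∫ h in Metric.ball (0 : Plane) s, w x‖ₑ := by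
      rw [setIntegral_const, enorm_smul, Measure.real, ← hV, Real.enorm_of_nonneg (by simp),
        ENNReal.ofReal_toReal hVtop]
    have h2 : ∫ h in Metric.ball (0 : Plane) s, w x =
        (∫ h in Metric.ball (0 : Plane) s, w (x + h)) -
          ∫ h in Metric.ball (0 : Plane) s, (w (x + h) - w x) := by
      rw [integral_sub (hint _ hwx) (hint _ continuous_const)]
      ring
    have h3 : ‖∫ h in Metric.ball (0 : Plane) s, (w (x + h) - w x)‖ₑ ^ 2 ≤
        V * ∫⁻ h in Metric.ball (0 : Plane) s, ‖w (x + h) - w x‖ₑ ^ 2 := by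
      refine (pow_le_pow_left' (enorm_integral_le_lintegral_enorm _) 2).trans ?_
      refine (sq_lintegral_le _ (hwx.sub continuous_const).enorm.measurable.aemeasurable).trans ?_
      simp [hV]
    have h4 : ∀ a b : ENNReal, (a + b) ^ 2 ≤ 2 * b ^ 2 + 2 * a ^ 2 := by
      intro a b
      have := ENNReal.rpow_add_le_mul_rpow_add_rpow a b (p := 2) (by norm_num)
      norm_num at this
      rw [← mul_add, add_comm (b ^ 2)]
      exact this
    rw [← mul_pow, h1, h2]
    refine (pow_le_pow_left' enorm_sub_le 2).trans ?_
    refine (h4 _ _).trans ?_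
    gcongr
  have hA : Measurable fun x => ‖∫ h in Metric.ball (0 : Plane) s, w (x + h)‖ₑ ^ 2 := by
    have : Continuous fun p : Plane × Plane => w (p.1 + p.2) := hw.continuous.comp (by fun_prop)
    exact (this.stronglyMeasurable.integral_prod_right
      (ν := volume.restrict (Metric.ball (0 : Plane) s))).enorm.pow_const 2
  calc V ^ 2 * ∫⁻ x in Metric.ball x₀ r, ‖w x‖ₑ ^ 2
      = ∫⁻ x in Metric.ball x₀ r, V ^ 2 * ‖w x‖ₑ ^ 2 :=
        (lintegral_const_mul' _ _ (ENNReal.pow_ne_top hVtop)).symm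
    _ ≤ ∫⁻ x in Metric.ball x₀ r,
          (2 * (V * ∫⁻ h in Metric.ball (0 : Plane) s, ‖w (x + h) - w x‖ₑ ^ 2)
          + 2 * ‖∫ h in Metric.ball (0 : Plane) s, w (x + h)‖ₑ ^ 2) := lintegral_mono hpt
    _ = 2 * (V * ∫⁻ x in Metric.ball x₀ r,
          ∫⁻ h in Metric.ball (0 : Plane) s, ‖w (x + h) - w x‖ₑ ^ 2)
        + 2 * ∫⁻ x in Metric.ball x₀ r, ‖∫ h in Metric.ball (0 : Plane) s, w (x + h)‖ₑ ^ 2 := by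
        rw [lintegral_add_right _ (hA.const_mul 2), lintegral_const_mul' _ _ (by simp),
          lintegral_const_mul' _ _ hVtop, lintegral_const_mul' _ _ (by simp)]
    _ = 2 * (V * ∫⁻ h in Metric.ball (0 : Plane) s,
          ∫⁻ x in Metric.ball x₀ r, ‖w (x + h) - w x‖ₑ ^ 2)
        + 2 * ∫⁻ x in Metric.ball x₀ r, ‖∫ h in Metric.ball (0 : Plane) s, w (x + h)‖ₑ ^ 2 := by
        rw [lintegral_lintegral_swap hjoint.measurable.aemeasurable]
    _ ≤ 2 * (V * ∫⁻ _h in Metric.ball (0 : Plane) s,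
          ENNReal.ofReal s ^ 2 * ∫⁻ x in Ω, gradSq w x)
        + 2 * ∫⁻ x in Metric.ball x₀ r, ‖∫ h in Metric.ball (0 : Plane) s, w (x + h)‖ₑ ^ 2 := by
        gcongr 2 * (V * ?_) + _
        refine setLIntegral_mono measurable_const fun h hh => ?_
        rw [mem_ball_zero_iff] at hh
        refine (lintegral_enorm_translate_sub_sq_le hΩ hw hball hh.le).trans ?_
        gcongr
        rw [← ofReal_norm]
        exact ENNReal.ofReal_le_ofReal hh.le
    _ = _ := by
        rw [setLIntegral_const, ← hV]
        ring

/-- Smooth functions which are bounded in `H¹(Ω)` and whose averages over small balls tend to `0`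
tend to `0` in `L²` near each point of `Ω`. -/
theorem tendsto_lintegral_ball_enorm_sq {Ω : Set Plane} (hΩ : MeasurableSet Ω)
    {w : ℕ → Plane → ℂ} (hw : ∀ m, ContDiff ℝ ∞ (w m)) {C : ENNReal} (hC : C ≠ ⊤)
    (hgrad : ∀ m, ∫⁻ x in Ω, gradSq (w m) x ≤ C) (hL2 : ∀ m, ∫⁻ x in Ω, ‖w m x‖ₑ ^ 2 ≤ C)
    {x₀ : Plane} {r s₀ : ℝ} (hs₀ : 0 < s₀) (hball : Metric.ball x₀ (r + s₀) ⊆ Ω)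
    (havg : ∀ s ≤ s₀, ∀ x ∈ Metric.ball x₀ r,
      Tendsto (fun m => ∫ h in Metric.ball (0 : Plane) s, w m (x + h)) atTop (𝓝 0)) :
    Tendsto (fun m => ∫⁻ x in Metric.ball x₀ r, ‖w m x‖ₑ ^ 2) atTop (𝓝 0) := by
  -- the averages converge to `0` boundedly, hence in `L²` of the ball
  have hdct : ∀ s ≤ s₀, Tendsto (fun m => ∫⁻ x in Metric.ball x₀ r,
      ‖∫ h in Metric.ball (0 : Plane) s, w m (x + h)‖ₑ ^ 2) atTop (𝓝 0) := by
    intro s hs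
    set V := volume (Metric.ball (0 : Plane) s) with hV
    have hVtop : V ≠ ⊤ := measure_ball_lt_top.ne
    have := tendsto_lintegral_of_dominated_convergence
      (μ := volume.restrict (Metric.ball x₀ r))
      (F := fun m x => ‖∫ h in Metric.ball (0 : Plane) s, w m (x + h)‖ₑ ^ 2) (f := fun _ => 0)
      (fun _ => V * C) ?_ ?_ ?_ ?_
    · simpa using this
    · intro m
      have : Continuous fun p : Plane × Plane => w m (p.1 + p.2) :=
        (hw m).continuous.comp (by fun_prop)
      exact (this.stronglyMeasurable.integral_prod_right
        (ν := volume.restrict (Metric.ball (0 : Plane) s))).enorm.pow_const 2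
    · intro m
      refine (ae_restrict_iff' measurableSet_ball).2 (Eventually.of_forall fun x hx => ?_)
      have hwx : Continuous fun h => w m (x + h) := (hw m).continuous.comp (by fun_prop)
      refine (pow_le_pow_left' (enorm_integral_le_lintegral_enorm _) 2).trans ?_
      refine (sq_lintegral_le _ hwx.enorm.measurable.aemeasurable).trans ?_
      rw [Measure.restrict_apply_univ]
      refine mul_le_mul' le_rfl (le_trans ?_ (hL2 m))
      rw [← lintegral_indicator hΩ, ← lintegral_indicator measurableSet_ball,
        ← lintegral_add_left_eq_self (μ := volume) (Ω.indicator fun x => ‖w m x‖ₑ ^ 2) x]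
      refine lintegral_mono fun h => ?_
      by_cases hh : h ∈ Metric.ball (0 : Plane) s
      · have : x + h ∈ Ω := by
          refine hball ?_
          rw [mem_ball_zero_iff] at hh
          rw [Metric.mem_ball, dist_eq_norm] at hx ⊢
          calc ‖x + h - x₀‖ = ‖(x - x₀) + h‖ := by congr 1; abel
            _ ≤ _ := norm_add_le _ _
            _ < r + s₀ := by linarith
        simp [hh, this]
      · simp [hh]
    · rw [setLIntegral_const]
      exact ENNReal.mul_ne_top (ENNReal.mul_ne_top hVtop hC) measure_ball_lt_top.ne
    · refine (ae_restrict_iff' measurableSet_ball).2 (Eventually.of_forall fun x hx => ?_)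
      have := ((ENNReal.continuous_pow 2).tendsto _).comp ((havg s hs x hx).enorm)
      simpa [Function.comp_def] using this
  -- what is left in the limit is the distance of `w m` from its averages, which is of order `s`
  have hlim : ∀ s, 0 < s → s ≤ s₀ →
      limsup (fun m => ∫⁻ x in Metric.ball x₀ r, ‖w m x‖ₑ ^ 2) atTop ≤
        2 * (ENNReal.ofReal s ^ 2 * C) := by
    intro s hs hs'
    set V := volume (Metric.ball (0 : Plane) s) with hV
    have hVtop : V ^ 2 ≠ ⊤ := ENNReal.pow_ne_top measure_ball_lt_top.ne
    have hV0 : V ^ 2 ≠ 0 := pow_ne_zero _ (Metric.measure_ball_pos _ _ hs).ne'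
    have hb : ∀ m, ∫⁻ x in Metric.ball x₀ r, ‖w m x‖ₑ ^ 2 ≤ 2 * (ENNReal.ofReal s ^ 2 * C) +
        (V ^ 2)⁻¹ * (2 * ∫⁻ x in Metric.ball x₀ r,
          ‖∫ h in Metric.ball (0 : Plane) s, w m (x + h)‖ₑ ^ 2) := by
      intro m
      have h1 := lintegral_enorm_sq_le_gradSq_add_average hΩ (hw m) (x₀ := x₀) (r := r) (s := s)
        ((Metric.ball_subset_ball (by linarith)).trans hball)
      rw [← hV] at h1
      have h2 : ∀ a b c : ENNReal, V ^ 2 * a ≤ 2 * (V ^ 2 * b) + c → a ≤ 2 * b + (V ^ 2)⁻¹ * c := by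
        intro a b c h
        calc a = (V ^ 2)⁻¹ * (V ^ 2 * a) := by
              rw [← mul_assoc, ENNReal.inv_mul_cancel hV0 hVtop, one_mul]
          _ ≤ (V ^ 2)⁻¹ * (2 * (V ^ 2 * b) + c) := by gcongr
          _ = ((V ^ 2)⁻¹ * V ^ 2) * (2 * b) + (V ^ 2)⁻¹ * c := by ring
          _ = _ := by rw [ENNReal.inv_mul_cancel hV0 hVtop, one_mul]
      refine (h2 _ _ _ h1).trans ?_
      gcongr
      exact hgrad m
    have ht : Tendsto (fun m => 2 * (ENNReal.ofReal s ^ 2 * C) +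
        (V ^ 2)⁻¹ * (2 * ∫⁻ x in Metric.ball x₀ r,
          ‖∫ h in Metric.ball (0 : Plane) s, w m (x + h)‖ₑ ^ 2)) atTop
        (𝓝 (2 * (ENNReal.ofReal s ^ 2 * C) + (V ^ 2)⁻¹ * (2 * 0))) := by
      refine tendsto_const_nhds.add (ENNReal.Tendsto.const_mul
        (ENNReal.Tendsto.const_mul (hdct s hs') (Or.inr (by simp))) (Or.inr ?_))
      exact ENNReal.inv_ne_top.2 hV0
    rw [mul_zero, mul_zero, add_zero] at ht
    rw [← ht.limsup_eq]
    exact limsup_le_limsup (Eventually.of_forall hb)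
  refine tendsto_of_le_liminf_of_limsup_le bot_le ?_
  have ht : Tendsto (fun s : ℝ => 2 * (ENNReal.ofReal s ^ 2 * C)) (𝓝[>] 0)
      (𝓝 (2 * (ENNReal.ofReal 0 ^ 2 * C))) := by
    refine Tendsto.mono_left ?_ nhdsWithin_le_nhds
    refine ENNReal.Tendsto.const_mul (ENNReal.Tendsto.mul_const ?_ (Or.inr hC)) (Or.inr (by simp))
    exact ((ENNReal.continuous_pow 2).comp ENNReal.continuous_ofReal).tendsto 0
  simp only [ENNReal.ofReal_zero, ne_eq, OfNat.ofNat_ne_zero, not_false_eq_true, zero_pow,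
    zero_mul, mul_zero] at ht
  refine ge_of_tendsto ht ?_
  filter_upwards [Ioc_mem_nhdsGT hs₀] with s hs using hlim s hs.1 hs.2

/-! ### First-order jets of smooth functions in `L²` -/

/-- `L²(Ω; ℂ)`. -/
abbrev L2Space (Ω : Set Plane) : Type := Lp ℂ 2 (volume.restrict Ω)

/-- `L²(Ω; ℂ)³`, home of the triples consisting of a function (at the index `none`) and its two
partial derivatives (at `some i`). -/
abbrev JetSpace (Ω : Set Plane) : Type := Option (Fin 2) → L2Space Ω

/-- The triple `(φ, ∂₀φ, ∂₁φ)` for a smooth function `φ`. -/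
noncomputable def smoothJet (φ : Plane → ℂ) : Option (Fin 2) → Plane → ℂ
  | none => φ
  | some i => fun x => fderiv ℝ φ x (stdVec i)

/-- The triple formed by a function and its weak partial derivatives. -/
noncomputable def weakJet (Ω : Set Plane) (u : Plane → ℂ) : Option (Fin 2) → Plane → ℂ
  | none => u
  | some i => weakPartial Ω i u

theorem continuous_smoothJet {φ : Plane → ℂ} (hφ : ContDiff ℝ ∞ φ) (o : Option (Fin 2)) :
    Continuous (smoothJet φ o) := by
  cases o with
  | none => exact hφ.continuous
  | some i => exact continuous_fderiv_stdVec hφ i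

theorem contDiff_add_smul {φ ψ : Plane → ℂ} (hφ : ContDiff ℝ ∞ φ) (hψ : ContDiff ℝ ∞ ψ) (a b : ℝ) :
    ContDiff ℝ ∞ fun x => a • φ x + b • ψ x :=
  (hφ.const_smul a).add (hψ.const_smul b)

theorem smoothJet_add_smul {φ ψ : Plane → ℂ} (hφ : ContDiff ℝ ∞ φ) (hψ : ContDiff ℝ ∞ ψ)
    (a b : ℝ) (o : Option (Fin 2)) :
    smoothJet (fun x => a • φ x + b • ψ x) o = fun x => a • smoothJet φ o x + b • smoothJet ψ o x := by
  have h1 : Differentiable ℝ φ := hφ.differentiable (by simp)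
  have h2 : Differentiable ℝ ψ := hψ.differentiable (by simp)
  cases o with
  | none => rfl
  | some i =>
    funext x
    simp only [smoothJet]
    have h : HasFDerivAt (fun x => a • φ x + b • ψ x) (a • fderiv ℝ φ x + b • fderiv ℝ ψ x) x :=
      ((h1 x).hasFDerivAt.const_smul a).add ((h2 x).hasFDerivAt.const_smul b)
    rw [h.fderiv]
    rfl

theorem isFiniteMeasure_restrict_of_isBounded {Ω : Set Plane} (hΩ : Bornology.IsBounded Ω) :
    IsFiniteMeasure (volume.restrict Ω) :=
  ⟨by rw [Measure.restrict_apply_univ]; exact hΩ.measure_lt_top⟩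

theorem Continuous.memLp_restrict_of_isBounded {Ω : Set Plane} (hm : MeasurableSet Ω)
    (hΩ : Bornology.IsBounded Ω) {f : Plane → ℂ} (hf : Continuous f) (p : ENNReal) :
    MemLp f p (volume.restrict Ω) := by
  have := isFiniteMeasure_restrict_of_isBounded hΩ
  obtain ⟨C, hC⟩ := hΩ.isCompact_closure.exists_bound_of_continuousOn hf.continuousOn
  exact MemLp.of_bound hf.aestronglyMeasurable C
    ((ae_restrict_iff' hm).2 (Eventually.of_forall fun x hx => hC x (subset_closure hx)))

theorem MeasureTheory.MemLp.locallyIntegrableOn_of_isBounded {Ω : Set Plane}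
    (hΩ : Bornology.IsBounded Ω) {f : Plane → ℂ} (hf : MemLp f 2 (volume.restrict Ω)) : LocallyIntegrableOn f Ω := by
  have := isFiniteMeasure_restrict_of_isBounded hΩ
  have h : IntegrableOn f Ω := hf.integrable (by norm_num)
  exact h.locallyIntegrableOn

/-- Integration against a continuous function is a continuous linear functional on `L²(Ω)`. -/
theorem exists_clm_eq_setIntegral_smul {Ω : Set Plane} (hm : MeasurableSet Ω)
    (hΩ : Bornology.IsBounded Ω) {ψ : Plane → ℝ} (hψ : Continuous ψ) :
    ∃ L : L2Space Ω →L[ℝ] ℂ, ∀ U, L U = ∫ x in Ω, ψ x • U x := by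
  have hmem : MemLp (fun x => (ψ x : ℂ)) 2 (volume.restrict Ω) :=
    (Complex.continuous_ofReal.comp hψ).memLp_restrict_of_isBounded hm hΩ 2
  refine ⟨(innerSL ℂ hmem.toLp).restrictScalars ℝ, fun U => ?_⟩
  rw [ContinuousLinearMap.coe_restrictScalars', innerSL_apply_apply, L2.inner_def]
  refine integral_congr_ae ?_
  filter_upwards [hmem.coeFn_toLp] with x hx
  rw [hx]
  simp [mul_comm]

/-- Integration over a ball contained in `Ω` is a continuous linear functional on `L²(Ω)`. -/
theorem exists_clm_eq_setIntegral_ball {Ω : Set Plane} {x : Plane} {s : ℝ}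
    (hball : Metric.ball x s ⊆ Ω) :
    ∃ L : L2Space Ω →L[ℝ] ℂ, ∀ U, L U = ∫ y in Metric.ball x s, U y := by
  have hfin : (volume.restrict Ω) (Metric.ball x s) ≠ ⊤ :=
    ((Measure.restrict_apply_le _ _).trans_lt measure_ball_lt_top).ne
  refine ⟨(innerSL ℂ (indicatorConstLp 2 measurableSet_ball hfin (1 : ℂ))).restrictScalars ℝ,
    fun U => ?_⟩
  rw [ContinuousLinearMap.coe_restrictScalars', innerSL_apply_apply,
    L2.inner_indicatorConstLp_one, Measure.restrict_restrict measurableSet_ball,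
    Set.inter_eq_left.2 hball]

/-- The classical partial derivatives of a smooth function are its weak partial derivatives. -/
theorem isWeakPartial_of_contDiff {Ω : Set Plane} {u : Plane → ℂ}
    (hu : ContDiff ℝ ∞ u) (i : Fin 2) : IsWeakPartial Ω i u fun x => fderiv ℝ u x (stdVec i) := by
  refine ⟨hu.continuous.locallyIntegrable.locallyIntegrableOn Ω,
    (continuous_fderiv_stdVec hu i).locallyIntegrable.locallyIntegrableOn Ω, ?_⟩
  intro φ hφ hc hs
  have hz : ∀ f : Plane → ℂ, (∀ x, x ∉ tsupport φ → f x = 0) → ∫ x in Ω, f x = ∫ x, f x :=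
    fun f hf => setIntegral_eq_integral_of_forall_compl_eq_zero fun x hx => hf x fun h => hx (hs h)
  have h0 : ∀ x, x ∉ tsupport φ → fderiv ℝ φ x = 0 := fun x hx =>
    image_eq_zero_of_notMem_tsupport fun h => hx (tsupport_fderiv_subset ℝ h)
  rw [hz _ fun x hx => by simp [h0 x hx],
    hz _ fun x hx => by simp [image_eq_zero_of_notMem_tsupport hx]]
  have hφ' : Continuous fun x => fderiv ℝ φ x (stdVec i) :=
    (hφ.continuous_fderiv (by simp)).clm_apply continuous_const
  have key := integral_smul_fderiv_eq_neg_fderiv_smul_of_integrable (μ := (volume : Measure Plane))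
    (f := φ) (g := u) (v := stdVec i) ?_ ?_ ?_
    (fun x _ => hφ.differentiable (by simp) x) (fun x _ => hu.differentiable (by simp) x)
  · rw [key, neg_neg]
  · refine (hφ'.smul hu.continuous).integrable_of_hasCompactSupport ?_
    exact (hc.fderiv_apply (𝕜 := ℝ) (stdVec i)).smul_right
  · exact (hφ.continuous.smul (continuous_fderiv_stdVec hu i)).integrable_of_hasCompactSupport
      hc.smul_right
  · exact (hφ.continuous.smul hu.continuous).integrable_of_hasCompactSupport hc.smul_right

theorem weakPartial_ae_eq {Ω : Set Plane} (hΩ : IsOpen Ω) {i : Fin 2} {u v : Plane → ℂ}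
    (h : IsWeakPartial Ω i u v) : weakPartial Ω i u =ᵐ[volume.restrict Ω] v := by
  have hex : ∃ v, IsWeakPartial Ω i u v := ⟨v, h⟩
  rw [weakPartial, dif_pos hex]
  exact hex.choose_spec.ae_eq hΩ h

theorem MemH1.memLp_weakJet {Ω : Set Plane} (hΩ : IsOpen Ω) {u : Plane → ℂ} (hu : MemH1 Ω u)
    (o : Option (Fin 2)) : MemLp (weakJet Ω u o) 2 (volume.restrict Ω) := by
  cases o with
  | none => exact hu.1
  | some i =>
    obtain ⟨v, hv, hv2⟩ := hu.2 i
    exact hv2.ae_eq (weakPartial_ae_eq hΩ hv).symm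

/-- The subspace of `L²(Ω)³` formed by the first-order jets of smooth functions on the plane. -/
noncomputable def smoothJets (Ω : Set Plane) : Submodule ℝ (JetSpace Ω) where
  carrier := {U | ∃ φ : Plane → ℂ, ContDiff ℝ ∞ φ ∧
    ∀ o, U o =ᵐ[volume.restrict Ω] smoothJet φ o}
  zero_mem' := ⟨fun _ => 0, contDiff_const, fun o => by
    filter_upwards [Lp.coeFn_zero ℂ 2 (volume.restrict Ω)] with x hx
    have e : smoothJet (fun _ => 0) o x = 0 := by cases o <;> simp [smoothJet]
    rw [e]
    exact hx⟩
  add_mem' := by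
    rintro U V ⟨φ, hφ, hU⟩ ⟨ψ, hψ, hV⟩
    refine ⟨fun x => (1 : ℝ) • φ x + (1 : ℝ) • ψ x,
      contDiff_add_smul hφ hψ _ _, fun o => ?_⟩
    rw [smoothJet_add_smul hφ hψ]
    filter_upwards [hU o, hV o, Lp.coeFn_add (U o) (V o)] with x h1 h2 h3
    rw [Pi.add_apply, h3, Pi.add_apply, h1, h2, one_smul, one_smul]
  smul_mem' := by
    rintro c U ⟨φ, hφ, hU⟩
    refine ⟨fun x => c • φ x + (0 : ℝ) • φ x,
      contDiff_add_smul hφ hφ _ _, fun o => ?_⟩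
    rw [smoothJet_add_smul hφ hφ]
    filter_upwards [hU o, Lp.coeFn_smul c (U o)] with x h1 h3
    rw [Pi.smul_apply, h3, Pi.smul_apply, h1, zero_smul, add_zero]

/-- The jets of those smooth functions whose boundary values are within `ε` of `g` in `L²(∂Ω)`. -/
def smoothJetsNear {Ω : Set Plane} (g : frontier Ω → Circle) (ε : ENNReal) : Set (JetSpace Ω) :=
  {U | ∃ φ : Plane → ℂ, ContDiff ℝ ∞ φ ∧ (∀ o, U o =ᵐ[volume.restrict Ω] smoothJet φ o) ∧
    eLpNorm (fun x : frontier Ω => φ x - (g x : ℂ)) 2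
      (Measure.hausdorffMeasure 1 : Measure (frontier Ω)) ≤ ε}

theorem smoothJetsNear_subset {Ω : Set Plane} (g : frontier Ω → Circle) (ε : ENNReal) :
    smoothJetsNear g ε ⊆ smoothJets Ω :=
  fun _ ⟨φ, hφ, hU, _⟩ => ⟨φ, hφ, hU⟩

theorem convex_smoothJetsNear {Ω : Set Plane} {g : frontier Ω → Circle} (hg : Continuous g)
    (ε : ENNReal) : Convex ℝ (smoothJetsNear g ε) := by
  rintro U ⟨φ, hφ, hU, hφb⟩ V ⟨ψ, hψ, hV, hψb⟩ a b ha hb hab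
  refine ⟨fun x => a • φ x + b • ψ x,
      contDiff_add_smul hφ hψ _ _, fun o => ?_, ?_⟩
  · rw [smoothJet_add_smul hφ hψ]
    filter_upwards [hU o, hV o, Lp.coeFn_add (a • U o) (b • V o), Lp.coeFn_smul a (U o),
      Lp.coeFn_smul b (V o)] with x h1 h2 h3 h4 h5
    rw [Pi.add_apply, Pi.smul_apply, Pi.smul_apply, h3, Pi.add_apply, h4, h5, Pi.smul_apply,
      Pi.smul_apply, h1, h2]
  · set ν := (Measure.hausdorffMeasure 1 : Measure (frontier Ω))
    have hgc : Continuous fun x : frontier Ω => (g x : ℂ) := continuous_subtype_val.comp hg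
    have hm : ∀ χ : Plane → ℂ, ContDiff ℝ ∞ χ →
        AEStronglyMeasurable (fun x : frontier Ω => χ x - (g x : ℂ)) ν := fun χ hχ =>
      ((hχ.continuous.comp continuous_subtype_val).sub hgc).aestronglyMeasurable
    have e : (fun x : frontier Ω => (a • φ x + b • ψ x) - (g x : ℂ)) =
        a • (fun x : frontier Ω => φ x - (g x : ℂ)) + b • fun x : frontier Ω => ψ x - (g x : ℂ) := by
      funext x
      have : (g x : ℂ) = a • (g x : ℂ) + b • (g x : ℂ) := by rw [← add_smul, hab, one_smul]
      simp only [Pi.add_apply, Pi.smul_apply, smul_sub]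
      conv_lhs => rw [this]
      abel
    rw [e]
    refine (eLpNorm_add_le ((hm φ hφ).const_smul a) ((hm ψ hψ).const_smul b) (by norm_num)).trans ?_
    rw [eLpNorm_const_smul, eLpNorm_const_smul, Real.enorm_of_nonneg ha, Real.enorm_of_nonneg hb]
    calc _ ≤ ENNReal.ofReal a * ε + ENNReal.ofReal b * ε := by gcongr
      _ = ε := by
        rw [← add_mul, ← ENNReal.ofReal_add ha hb, hab, ENNReal.ofReal_one, one_mul]

/-- Limits of smooth jets are weak jets, because integration by parts against a fixed test function
is a closed condition. -/
theorem isWeakPartial_of_mem_closure_smoothJets {Ω : Set Plane} (hΩ : IsOpen Ω)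
    (hb : Bornology.IsBounded Ω) {U : JetSpace Ω}
    (hU : U ∈ closure (smoothJets Ω : Set (JetSpace Ω)))
    (i : Fin 2) : IsWeakPartial Ω i (U none) (U (some i)) := by
  refine ⟨(Lp.memLp _).locallyIntegrableOn_of_isBounded hb,
    (Lp.memLp _).locallyIntegrableOn_of_isBounded hb, fun φ hφ hc hs => ?_⟩
  obtain ⟨L, hL⟩ := exists_clm_eq_setIntegral_smul hΩ.measurableSet hb hφ.continuous
  obtain ⟨L', hL'⟩ := exists_clm_eq_setIntegral_smul hΩ.measurableSet hb
    ((hφ.continuous_fderiv (by simp)).clm_apply (continuous_const (y := stdVec i)))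
  have hclosed : IsClosed {V : JetSpace Ω | L' (V none) = - L (V (some i))} :=
    isClosed_eq (L'.continuous.comp (continuous_apply none))
      (L.continuous.comp (continuous_apply (some i))).neg
  have hsub : (smoothJets Ω : Set (JetSpace Ω)) ⊆ {V | L' (V none) = - L (V (some i))} := by
    rintro V ⟨ψ, hψ, hV⟩
    have h := (isWeakPartial_of_contDiff (Ω := Ω) hψ i).2.2 φ hφ hc hs
    rw [Set.mem_ofPred_eq, hL, hL']
    refine Eq.trans (integral_congr_ae ?_) (h.trans (congrArg _ (integral_congr_ae ?_)))
    · filter_upwards [hV none] with x hx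
      rw [hx]
      rfl
    · filter_upwards [hV (some i)] with x hx
      rw [hx]
      rfl
  have := closure_minimal hsub hclosed hU
  rwa [Set.mem_ofPred_eq, hL, hL'] at this

/-! ### Limits of smooth jets: local compactness and traces -/

theorem lintegral_enorm_sq_eq_eLpNorm {α : Type*} [MeasurableSpace α] (μ : Measure α) (f : α → ℂ) :
    ∫⁻ x, ‖f x‖ₑ ^ 2 ∂μ = eLpNorm f 2 μ ^ 2 := by
  rw [eLpNorm_eq_lintegral_rpow_enorm_toReal (by norm_num) (by norm_num), ← ENNReal.rpow_natCast,
    ← ENNReal.rpow_mul]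
  simp

theorem lintegral_enorm_sq_eq_enorm {α : Type*} [MeasurableSpace α] {μ : Measure α}
    {f : α → ℂ} {U : Lp ℂ 2 μ} (h : U =ᵐ[μ] f) : ∫⁻ x, ‖f x‖ₑ ^ 2 ∂μ = ‖U‖ₑ ^ 2 := by
  rw [lintegral_enorm_sq_eq_eLpNorm, Lp.enorm_def, eLpNorm_congr_ae h]

/-- A sequence of jets of smooth functions tending weakly to `0` tends to `0` strongly in `L²` near
each point of `Ω`. -/
theorem tendsto_eLpNorm_ball_of_smoothJet {Ω : Set Plane} (hΩ : IsOpen Ω)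
    {W : ℕ → JetSpace Ω} {φ : ℕ → Plane → ℂ} (hφ : ∀ m, ContDiff ℝ ∞ (φ m))
    (hWφ : ∀ m o, W m o =ᵐ[volume.restrict Ω] smoothJet (φ m) o)
    (hWw : WeakTendsto W 0) {C : ℝ} (hC : ∀ m, ‖W m‖ ≤ C)
    {x₀ : Plane} {r s₀ : ℝ} (hs₀ : 0 < s₀) (hball : Metric.ball x₀ (r + s₀) ⊆ Ω) :
    Tendsto (fun m => eLpNorm (W m none) 2 (volume.restrict (Metric.ball x₀ r))) atTop (𝓝 0) := by
  have hWC : ∀ m o, ‖W m o‖ₑ ≤ ENNReal.ofReal C := fun m o => by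
    rw [← ofReal_norm]
    exact ENNReal.ofReal_le_ofReal ((norm_le_pi_norm (W m) o).trans (hC m))
  have hball' : Metric.ball x₀ r ⊆ Ω := (Metric.ball_subset_ball (by linarith)).trans hball
  have hμ : volume.restrict (Metric.ball x₀ r) ≤ volume.restrict Ω :=
    Measure.restrict_mono hball' le_rfl
  have hφ0 : Tendsto (fun m => ∫⁻ x in Metric.ball x₀ r, ‖φ m x‖ₑ ^ 2) atTop (𝓝 0) := by
    refine tendsto_lintegral_ball_enorm_sq hΩ.measurableSet hφ
      (C := 2 * ENNReal.ofReal C ^ 2) ?_ ?_ ?_ hs₀ hball ?_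
    · exact ENNReal.mul_ne_top (by simp) (ENNReal.pow_ne_top ENNReal.ofReal_ne_top)
    · intro m
      have hme : ∀ i : Fin 2, Measurable fun x => ‖fderiv ℝ (φ m) x (stdVec i)‖ₑ ^ 2 := fun i =>
        (continuous_fderiv_stdVec (hφ m) i).enorm.measurable.pow_const 2
      simp only [gradSq]
      rw [lintegral_finsetSum _ fun i _ => hme i, Fin.sum_univ_two, two_mul]
      refine add_le_add ?_ ?_
      · exact (lintegral_enorm_sq_eq_enorm (hWφ m (some 0))).trans_le
          (pow_le_pow_left' (hWC m (some 0)) 2)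
      · exact (lintegral_enorm_sq_eq_enorm (hWφ m (some 1))).trans_le
          (pow_le_pow_left' (hWC m (some 1)) 2)
    · intro m
      rw [lintegral_enorm_sq_eq_enorm (f := φ m) (hWφ m none), two_mul]
      exact (pow_le_pow_left' (hWC m none) 2).trans le_self_add
    · intro s hs x hx
      have hxs : Metric.ball x s ⊆ Ω := by
        refine (Metric.ball_subset_ball' ?_).trans hball
        rw [Metric.mem_ball] at hx
        linarith
      obtain ⟨L, hL⟩ := exists_clm_eq_setIntegral_ball hxs
      have h1 := (hWw.map (L.comp (ContinuousLinearMap.proj none))).tendsto_complex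
      rw [map_zero] at h1
      refine h1.congr fun m => ?_
      rw [ContinuousLinearMap.comp_apply, ContinuousLinearMap.proj_apply, hL]
      have h2 : ∫ y in Metric.ball x s, W m none y = ∫ y in Metric.ball x s, φ m y :=
        integral_congr_ae (ae_restrict_of_ae_restrict_of_subset hxs (hWφ m none))
      rw [h2, ← integral_indicator measurableSet_ball, ← integral_indicator measurableSet_ball,
        ← integral_add_left_eq_self (μ := volume) _ x]
      congr 1
      funext h
      simp only [Set.indicator, Metric.mem_ball, dist_eq_norm, sub_zero, add_sub_cancel_left]
  have h1 := (ENNReal.continuous_rpow_const (y := 1 / 2)).tendsto 0 |>.comp hφ0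
  rw [ENNReal.zero_rpow_of_pos (by norm_num)] at h1
  refine h1.congr fun m => ?_
  rw [Function.comp_apply, lintegral_enorm_sq_eq_eLpNorm, ← ENNReal.rpow_natCast,
    ← ENNReal.rpow_mul]
  norm_num
  exact eLpNorm_congr_ae (EventuallyEq.symm (ae_mono hμ (hWφ m none)))

/-- A sequence of jets which are limits of smooth ones and tend weakly to `0` tends to `0`
strongly in `L²` near each point of `Ω`. -/
theorem tendsto_eLpNorm_ball_of_weakTendsto {Ω : Set Plane} (hΩ : IsOpen Ω)
    {V : ℕ → JetSpace Ω} (hV : ∀ m, V m ∈ closure (smoothJets Ω : Set (JetSpace Ω)))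
    (hw : WeakTendsto V 0) {C : ℝ} (hC : ∀ m, ‖V m‖ ≤ C)
    {x₀ : Plane} {r s₀ : ℝ} (hs₀ : 0 < s₀) (hball : Metric.ball x₀ (r + s₀) ⊆ Ω) :
    Tendsto (fun m => eLpNorm (V m none) 2 (volume.restrict (Metric.ball x₀ r))) atTop (𝓝 0) := by
  have hlim : Tendsto (fun m : ℕ => 1 / ((m : ℝ) + 1)) atTop (𝓝 0) :=
    tendsto_one_div_add_atTop_nhds_zero_nat
  have hex : ∀ m : ℕ, ∃ W ∈ (smoothJets Ω : Set (JetSpace Ω)), dist (V m) W < 1 / ((m : ℝ) + 1) :=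
    fun m => Metric.mem_closure_iff.1 (hV m) _ (by positivity)
  choose W hW hVW using hex
  choose φ hφ hWφ using hW
  -- smooth jets `W m` at vanishing distance from `V m` have the same weak limit
  have hdiff : Tendsto (fun m => V m - W m) atTop (𝓝 0) := by
    rw [tendsto_zero_iff_norm_tendsto_zero]
    refine squeeze_zero (fun _ => norm_nonneg _) (fun m => ?_) hlim
    rw [← dist_eq_norm]
    exact (hVW m).le
  have hWw : WeakTendsto W 0 := by
    have := hw.sub hdiff.weakTendsto
    simpa using this
  have hWC : ∀ m, ‖W m‖ ≤ C + 1 := by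
    intro m
    have h1 : 1 / ((m : ℝ) + 1) ≤ 1 := by
      rw [div_le_one (by positivity)]
      linarith [(Nat.cast_nonneg m : (0 : ℝ) ≤ m)]
    have h2 := hVW m
    rw [dist_comm, dist_eq_norm] at h2
    have h3 := norm_sub_norm_le (W m) (V m)
    linarith [hC m]
  have hball' : Metric.ball x₀ r ⊆ Ω := (Metric.ball_subset_ball (by linarith)).trans hball
  have hμ : volume.restrict (Metric.ball x₀ r) ≤ volume.restrict Ω :=
    Measure.restrict_mono hball' le_rfl
  have hWn := tendsto_eLpNorm_ball_of_smoothJet hΩ hφ hWφ hWw hWC hs₀ hball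
  have hsum : Tendsto (fun m : ℕ => ENNReal.ofReal (1 / ((m : ℝ) + 1)) +
      eLpNorm (W m none) 2 (volume.restrict (Metric.ball x₀ r))) atTop (𝓝 0) := by
    have h1 := (ENNReal.continuous_ofReal.tendsto 0).comp hlim
    simpa [Function.comp_def] using h1.add hWn
  refine tendsto_of_tendsto_of_tendsto_of_le_of_le tendsto_const_nhds hsum (fun _ => bot_le)
    fun m => ?_
  have e : eLpNorm (V m none) 2 (volume.restrict (Metric.ball x₀ r)) =
      eLpNorm (⇑(V m none - W m none) + ⇑(W m none)) 2
        (volume.restrict (Metric.ball x₀ r)) := by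
    refine eLpNorm_congr_ae (ae_mono hμ ?_)
    filter_upwards [Lp.coeFn_sub (V m none) (W m none)] with x hx
    rw [Pi.add_apply, hx, Pi.sub_apply, sub_add_cancel]
  dsimp only
  rw [e]
  refine (eLpNorm_add_le ((Lp.aestronglyMeasurable _).mono_measure hμ)
    ((Lp.aestronglyMeasurable _).mono_measure hμ) (by norm_num)).trans ?_
  gcongr
  refine (eLpNorm_mono_measure _ hμ).trans ?_
  rw [← Lp.enorm_def, ← ofReal_norm]
  refine ENNReal.ofReal_le_ofReal ?_
  have h1 := norm_le_pi_norm (V m - W m) none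
  have h2 := hVW m
  rw [dist_eq_norm] at h2
  exact h1.trans h2.le

/-- The jet of a function of `H¹` with trace `g` is a limit of smooth jets with boundary values
close to `g`. -/
theorem mem_closure_smoothJetsNear_of_hasTrace {Ω : Set Plane} (hΩ : IsOpen Ω)
    (hb : Bornology.IsBounded Ω) {g : frontier Ω → Circle} {u : Plane → ℂ} (hu : HasTrace u g)
    {U : JetSpace Ω} (hU : ∀ o, U o =ᵐ[volume.restrict Ω] weakJet Ω u o) {ε : ENNReal}
    (hε : 0 < ε) : U ∈ closure (smoothJetsNear g ε) := by
  obtain ⟨φ, hφ, h0, h1, hg⟩ := hu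
  have hmem : ∀ k o, MemLp (smoothJet (φ k) o) 2 (volume.restrict Ω) := fun k o =>
    (continuous_smoothJet (hφ k) o).memLp_restrict_of_isBounded hΩ.measurableSet hb 2
  have hlim : Tendsto (fun k o => (hmem k o).toLp) atTop (𝓝 U) := by
    rw [tendsto_pi_nhds]
    intro o
    rw [tendsto_iff_edist_tendsto_0]
    have h2 : Tendsto (fun k => eLpNorm (fun x => smoothJet (φ k) o x - weakJet Ω u o x) 2
        (volume.restrict Ω)) atTop (𝓝 0) := by
      cases o with
      | none => exact h0
      | some i => exact h1 i
    refine h2.congr fun k => ?_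
    rw [Lp.edist_def]
    refine eLpNorm_congr_ae ?_
    filter_upwards [(hmem k o).coeFn_toLp, hU o] with x hx hx'
    rw [Pi.sub_apply, hx, hx']
  refine mem_closure_of_tendsto hlim ?_
  filter_upwards [hg.eventually (ge_mem_nhds hε)] with k hk
  exact ⟨φ k, hφ k, fun o => (hmem k o).coeFn_toLp, hk⟩

/-- The first component of a jet that can be approximated by smooth jets with boundary values
arbitrarily close to `g` lies in `H¹` and has trace `g`. -/
theorem mem_H1WithBoundary_of_mem_closure {Ω : Set Plane} (hΩ : IsOpen Ω)
    (hb : Bornology.IsBounded Ω) {g : frontier Ω → Circle} {U : JetSpace Ω}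
    (hU : ∀ ε : ENNReal, 0 < ε → U ∈ closure (smoothJetsNear g ε)) :
    (U none : Plane → ℂ) ∈ H1WithBoundary g ∧
      ∀ o, U o =ᵐ[volume.restrict Ω] weakJet Ω (U none) o := by
  have hweak : ∀ i, IsWeakPartial Ω i (U none) (U (some i)) :=
    isWeakPartial_of_mem_closure_smoothJets hΩ hb
      (closure_mono (smoothJetsNear_subset g 1) (hU 1 one_pos))
  have hjet : ∀ o, U o =ᵐ[volume.restrict Ω] weakJet Ω (U none) o := by
    intro o
    cases o with
    | none => rfl
    | some i => exact (weakPartial_ae_eq hΩ (hweak i)).symm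
  refine ⟨⟨⟨Lp.memLp _, fun i => ⟨_, hweak i, Lp.memLp _⟩⟩, ?_⟩, hjet⟩
  have hlim : Tendsto (fun m : ℕ => ENNReal.ofReal (1 / ((m : ℝ) + 1))) atTop (𝓝 0) := by
    have h1 := (ENNReal.continuous_ofReal.tendsto 0).comp
      (tendsto_one_div_add_atTop_nhds_zero_nat (𝕜 := ℝ))
    simpa [Function.comp_def] using h1
  have hpos : ∀ k : ℕ, 0 < ENNReal.ofReal (1 / ((k : ℝ) + 1)) := fun k =>
    ENNReal.ofReal_pos.2 (by positivity)
  have hex : ∀ k : ℕ, ∃ W ∈ smoothJetsNear g (ENNReal.ofReal (1 / ((k : ℝ) + 1))),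
      edist U W < ENNReal.ofReal (1 / ((k : ℝ) + 1)) :=
    fun k => EMetric.mem_closure_iff.1 (hU _ (hpos k)) _ (hpos k)
  choose W hW hUW using hex
  choose φ hφ hWφ hb using hW
  have happ : ∀ o, Tendsto (fun k => eLpNorm (fun x => smoothJet (φ k) o x - weakJet Ω (U none) o x)
      2 (volume.restrict Ω)) atTop (𝓝 0) := by
    intro o
    refine tendsto_of_tendsto_of_tendsto_of_le_of_le tendsto_const_nhds hlim (fun _ => bot_le)
      fun k => ?_
    refine le_trans (le_of_eq ?_) ((edist_le_pi_edist (W k) U o).trans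
      (by rw [edist_comm]; exact (hUW k).le))
    rw [Lp.edist_def]
    refine eLpNorm_congr_ae ?_
    filter_upwards [hWφ k o, hjet o] with x hx hx'
    rw [Pi.sub_apply, hx, hx']
  exact ⟨φ, hφ, happ none, fun i => happ (some i),
    tendsto_of_tendsto_of_tendsto_of_le_of_le tendsto_const_nhds hlim (fun _ => bot_le) hb⟩

/-! ### Nonemptiness of the constraint class -/

/-- A smooth map on `∂Ω` is the restriction of a smooth map of the plane: local extensions are
glued by a partition of unity. -/
theorem IsSmoothBoundaryMap.exists_contDiff {Ω : Set Plane} {g : frontier Ω → Circle}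
    (hg : IsSmoothBoundaryMap g) :
    ∃ G : Plane → ℂ, ContDiff ℝ ∞ G ∧ ∀ q : frontier Ω, G q = (g q : ℂ) := by
  have hconv : ∀ x : Plane, Convex ℝ {z : ℂ | ∀ h : x ∈ frontier Ω, z = (g ⟨x, h⟩ : ℂ)} := by
    intro x z hz z' hz' a b _ _ hab h
    have h1 : z = (g ⟨x, h⟩ : ℂ) := hz h
    have h2 : z' = (g ⟨x, h⟩ : ℂ) := hz' h
    rw [h1, h2, ← add_smul, hab, one_smul]
  obtain ⟨G, hG⟩ := exists_contMDiffMap_forall_mem_convex_of_local (n := (⊤ : ℕ∞))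
    (modelWithCornersSelf ℝ Plane) hconv (by
      intro x
      by_cases hx : x ∈ frontier Ω
      · obtain ⟨U, hU, hxU, G, hG, hGg⟩ := hg ⟨x, hx⟩
        exact ⟨U, hU.mem_nhds hxU, G, hG.contMDiffOn, fun y hy h => hGg ⟨y, h⟩ hy⟩
      · refine ⟨(frontier Ω)ᶜ, isClosed_frontier.isOpen_compl.mem_nhds hx, fun _ => 0,
          contMDiffOn_const, fun y hy h => absurd h hy⟩)
  exact ⟨G, G.contMDiff.contDiff, fun q => hG q q.2⟩

theorem IsSmoothBoundaryMap.continuous {Ω : Set Plane} {g : frontier Ω → Circle}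
    (hg : IsSmoothBoundaryMap g) : Continuous g := by
  obtain ⟨G, hG, h⟩ := hg.exists_contDiff
  refine continuous_induced_rng.2 ?_
  have e : (Subtype.val ∘ g : frontier Ω → ℂ) = fun q : frontier Ω => G q := funext fun q => (h q).symm
  exact e ▸ hG.continuous.comp continuous_subtype_val

/-- A smooth function `G` from the plane to a space of real dimension at least `4` can be modified
off the set `|G|² = N` so as to take values in the sphere of radius `√N`. The cone
`{t G(x)}` has dimension at most `3`, so it misses some vector `a`; then `G - (N - |G|²) a` has no
zeros and can be normalized. -/
theorem exists_contDiff_norm_sq_eq {W : Type*} [NormedAddCommGroup W] [InnerProductSpace ℝ W]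
    [FiniteDimensional ℝ W] (hW : 3 < Module.finrank ℝ W) {G : Plane → W} (hG : ContDiff ℝ ∞ G)
    {N : ℝ} (hN : 0 < N) :
    ∃ u : Plane → W, ContDiff ℝ ∞ u ∧ (∀ x, ‖u x‖ ^ 2 = N) ∧
      ∀ x, ‖G x‖ ^ 2 = N → u x = G x := by
  have hcone : ContDiff ℝ 1 fun p : Plane × ℝ => p.2 • G p.1 :=
    contDiff_snd.smul ((hG.of_le (by simp)).comp contDiff_fst)
  obtain ⟨a, ha⟩ := (hcone.dense_compl_range_of_finrank_lt_finrank
    (by simpa [Module.finrank_prod] using hW)).nonempty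
  set q : Plane → W := fun x => G x - (N - ‖G x‖ ^ 2) • a with hq
  have hqs : ContDiff ℝ ∞ q := hG.sub ((contDiff_const.sub (hG.norm_sq ℝ)).smul contDiff_const)
  have hq0 : ∀ x, q x ≠ 0 := by
    intro x hx
    rw [hq, sub_eq_zero] at hx
    -- a zero of `q` with `|G x|² = N` has `G x = 0`, and any other one puts `a` in the cone
    by_cases h : N - ‖G x‖ ^ 2 = 0
    · rw [h, zero_smul] at hx
      rw [hx] at h
      simp at h
      linarith
    · refine ha ⟨(x, (N - ‖G x‖ ^ 2)⁻¹), ?_⟩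
      change (N - ‖G x‖ ^ 2)⁻¹ • G x = a
      rw [inv_smul_eq_iff₀ h]
      exact hx
  refine ⟨fun x => (√N / ‖q x‖) • q x, ?_, fun x => ?_, fun x hx => ?_⟩
  · exact (contDiff_const.div (hqs.norm ℝ hq0) fun x => norm_ne_zero_iff.2 (hq0 x)).smul hqs
  · rw [norm_smul, norm_div, norm_norm, Real.norm_of_nonneg (Real.sqrt_nonneg _),
      div_mul_cancel₀ _ (norm_ne_zero_iff.2 (hq0 x)), Real.sq_sqrt hN.le]
  · have e : q x = G x := by simp [hq, hx]
    have h : ‖G x‖ = √N := by rw [← hx, Real.sqrt_sq (norm_nonneg _)]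
    have h' : √N ≠ 0 := (Real.sqrt_pos.2 hN).ne'
    simp only [e, h, div_self h', one_smul]

theorem mem_H1WithBoundary_of_contDiff {Ω : Set Plane} (hΩ : IsOpen Ω)
    (hb : Bornology.IsBounded Ω) {g : frontier Ω → Circle} {u : Plane → ℂ} (hu : ContDiff ℝ ∞ u)
    (hug : ∀ q : frontier Ω, u q = (g q : ℂ)) : u ∈ H1WithBoundary g := by
  have hL2 : ∀ o, MemLp (smoothJet u o) 2 (volume.restrict Ω) := fun o =>
    (continuous_smoothJet hu o).memLp_restrict_of_isBounded hΩ.measurableSet hb 2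
  refine ⟨⟨hL2 none, fun i => ⟨_, isWeakPartial_of_contDiff hu i, hL2 (some i)⟩⟩,
    fun _ => u, fun _ => hu, ?_, fun i => ?_, ?_⟩
  · simp
  · refine tendsto_const_nhds.congr fun _ => ?_
    rw [← eLpNorm_zero (p := 2) (μ := volume.restrict Ω) (ε := ℂ)]
    refine eLpNorm_congr_ae ?_
    filter_upwards [weakPartial_ae_eq hΩ (isWeakPartial_of_contDiff (Ω := Ω) hu i)] with x hx
    simp [hx]
  · simp [hug]

theorem constraintClass_nonempty {Ω : Set Plane} (hΩ : IsOpen Ω) (hb : Bornology.IsBounded Ω)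
    {n : ℕ} (hn : 2 ≤ n) {g : Fin n → frontier Ω → Circle} (hg : ∀ j, IsSmoothBoundaryMap (g j)) :
    (constraintClass g).Nonempty := by
  choose G hG hGg using fun j => (hg j).exists_contDiff
  have hGs : ContDiff ℝ ∞ fun x => (WithLp.toLp 2 fun j => G j x : EuclideanSpace ℂ (Fin n)) :=
    PiLp.contDiff_toLp.comp (contDiff_pi.2 hG)
  have hdim : 3 < Module.finrank ℝ (EuclideanSpace ℂ (Fin n)) := by
    rw [← Module.finrank_mul_finrank ℝ ℂ, Complex.finrank_real_complex, finrank_euclideanSpace,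
      Fintype.card_fin]
    omega
  obtain ⟨u, hu, hun, huG⟩ := exists_contDiff_norm_sq_eq hdim hGs
    (N := n) (by exact_mod_cast (by omega : 0 < n))
  refine ⟨fun j x => u x j, fun j => ?_, Eventually.of_forall fun x => ?_⟩
  · refine mem_H1WithBoundary_of_contDiff hΩ hb ?_ fun q => ?_
    · exact ((EuclideanSpace.proj (𝕜 := ℂ) j).restrictScalars ℝ).contDiff.comp hu
    · have hnorm : ∀ i, ‖G i q‖ = 1 := fun i => by rw [hGg, Circle.norm_coe]
      have hq := huG q (by simp [EuclideanSpace.norm_sq_eq, hnorm])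
      exact (congrArg (fun v : EuclideanSpace ℂ (Fin n) => v j) hq).trans (hGg j q)
  · rw [← EuclideanSpace.norm_sq_eq, hun]

/-! ### Existence of minimizers -/

theorem norm_sq_eq_setIntegral_of_ae_eq {Ω : Set Plane} {f : Plane → ℂ} {U : L2Space Ω}
    (h : U =ᵐ[volume.restrict Ω] f) : ‖U‖ ^ 2 = ∫ x in Ω, ‖f x‖ ^ 2 := by
  rw [← real_inner_self_eq_norm_sq, L2.inner_def]
  refine integral_congr_ae ?_
  filter_upwards [h] with x hx
  rw [real_inner_self_eq_norm_sq, hx]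

theorem dirichletEnergy_eq_sum_norm_sq {n : ℕ} {Ω : Set Plane} {u : Fin n → Plane → ℂ}
    {U : Fin n → JetSpace Ω} (hU : ∀ j o, U j o =ᵐ[volume.restrict Ω] weakJet Ω (u j) o) :
    dirichletEnergy Ω u = ∑ j, ∑ i, ‖U j (some i)‖ ^ 2 := by
  refine Finset.sum_congr rfl fun j _ => ?_
  rw [integral_finsetSum]
  · exact Finset.sum_congr rfl fun i _ => (norm_sq_eq_setIntegral_of_ae_eq (hU j (some i))).symm
  · intro i _
    have h : MemLp (weakPartial Ω i (u j)) 2 (volume.restrict Ω) :=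
      (Lp.memLp (U j (some i))).ae_eq (hU j (some i))
    exact h.integrable_norm_pow (by norm_num)

theorem dirichletEnergy_nonneg {n : ℕ} (Ω : Set Plane) (u : Fin n → Plane → ℂ) :
    0 ≤ dirichletEnergy Ω u :=
  Finset.sum_nonneg fun _ _ => integral_nonneg fun _ => Finset.sum_nonneg fun _ _ => by positivity

theorem sum_norm_sq_eq_of_constraint {n : ℕ} {Ω : Set Plane} {u : Fin n → Plane → ℂ}
    {U : Fin n → L2Space Ω} (hU : ∀ j, U j =ᵐ[volume.restrict Ω] u j)
    (hu : ∀ᵐ x ∂(volume.restrict Ω), ∑ j, ‖u j x‖ ^ 2 = (n : ℝ)) :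
    ∑ j, ‖U j‖ ^ 2 = volume.real Ω * n := by
  have h : ∀ j, Integrable (fun x => ‖u j x‖ ^ 2) (volume.restrict Ω) := fun j =>
    ((Lp.memLp (U j)).ae_eq (hU j)).integrable_norm_pow (by norm_num)
  rw [Finset.sum_congr rfl fun j _ => norm_sq_eq_setIntegral_of_ae_eq (hU j),
    ← integral_finsetSum _ fun j _ => h j, integral_congr_ae hu, setIntegral_const, smul_eq_mul]

/-- The pointwise constraint `|u|² = N` passes to limits in `L²`, since
`| |u| - √N | ≤ |u - u'|` whenever `|u'|² = N`. -/
theorem ae_sum_norm_sq_eq_of_tendsto {n : ℕ} {N : ℝ} {α : Type*} [MeasurableSpace α]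
    {μ : Measure α} {u : Fin n → α → ℂ} {v : ℕ → Fin n → α → ℂ}
    (hu : ∀ j, AEStronglyMeasurable (u j) μ) (hv : ∀ m j, AEStronglyMeasurable (v m j) μ)
    (hvN : ∀ m, ∀ᵐ x ∂μ, ∑ j, ‖v m j x‖ ^ 2 = N)
    (h : ∀ j, Tendsto (fun m => eLpNorm (fun x => v m j x - u j x) 2 μ) atTop (𝓝 0)) :
    ∀ᵐ x ∂μ, ∑ j, ‖u j x‖ ^ 2 = N := by
  set f : α → ℝ := fun x => √(∑ j, ‖u j x‖ ^ 2) - √N with hf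
  have hfm : AEMeasurable f μ := by
    have : AEMeasurable (fun x => ∑ j, ‖u j x‖ ^ 2) μ :=
      Finset.aemeasurable_fun_sum _ fun j _ => (hu j).norm.aemeasurable.pow_const 2
    exact this.sqrt.sub aemeasurable_const
  have hbound : ∀ m, ∫⁻ x, ‖f x‖ₑ ^ 2 ∂μ ≤ ∑ j, eLpNorm (fun x => v m j x - u j x) 2 μ ^ 2 := by
    intro m
    simp_rw [← lintegral_enorm_sq_eq_eLpNorm]
    have hm : ∀ j, AEMeasurable (fun x => ‖v m j x - u j x‖ₑ ^ 2) μ := fun j =>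
      ((hv m j).sub (hu j)).enorm.pow_const 2
    rw [← lintegral_finsetSum' _ fun j _ => hm j]
    refine lintegral_mono_ae ?_
    filter_upwards [hvN m] with x hx
    have h1 := abs_norm_sub_norm_le (WithLp.toLp 2 fun j => u j x : EuclideanSpace ℂ (Fin n))
      (WithLp.toLp 2 fun j => v m j x)
    rw [norm_sub_rev, EuclideanSpace.norm_eq, EuclideanSpace.norm_eq] at h1
    simp only [hx] at h1
    have h2 := (sq_le_sq₀ (abs_nonneg _) (norm_nonneg _)).2 h1
    rw [EuclideanSpace.norm_sq_eq] at h2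
    rw [← ofReal_norm, ← ENNReal.ofReal_pow (norm_nonneg _)]
    refine (ENNReal.ofReal_le_ofReal h2).trans (le_of_eq ?_)
    rw [ENNReal.ofReal_sum_of_nonneg fun _ _ => by positivity]
    refine Finset.sum_congr rfl fun j _ => ?_
    rw [ENNReal.ofReal_pow (norm_nonneg _), ofReal_norm]
    rfl
  have hlim : Tendsto (fun m => ∑ j, eLpNorm (fun x => v m j x - u j x) 2 μ ^ 2) atTop (𝓝 0) := by
    have := tendsto_finsetSum Finset.univ fun j (_ : j ∈ Finset.univ) =>
      ((ENNReal.continuous_pow 2).tendsto 0).comp (h j)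
    simpa [Function.comp_def] using this
  have hzero : ∫⁻ x, ‖f x‖ₑ ^ 2 ∂μ = 0 :=
    le_antisymm (ge_of_tendsto' hlim hbound) bot_le
  rw [lintegral_eq_zero_iff' (hfm.enorm.pow_const 2)] at hzero
  rcases isEmpty_or_nonempty α with hα | hα
  · exact Eventually.of_forall fun x => hα.elim x
  filter_upwards [hzero, hvN 0] with x hx hx0
  have h1 : √(∑ j, ‖u j x‖ ^ 2) = √N := by simpa [hf, sub_eq_zero] using hx
  exact (Real.sqrt_inj (by positivity) (hx0 ▸ by positivity)).1 h1

/-- A property that holds almost everywhere near each point of an open set holds almost everywhere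
in it. -/
theorem ae_restrict_of_forall_ball {Ω : Set Plane} {p : Plane → Prop}
    (h : ∀ x ∈ Ω, ∃ r > 0, ∀ᵐ y ∂(volume.restrict (Metric.ball x r)), p y) :
    ∀ᵐ y ∂(volume.restrict Ω), p y := by
  choose! r hr hp using h
  obtain ⟨t, htΩ, ht, hcover⟩ := TopologicalSpace.countable_cover_nhdsWithin (s := Ω)
    (f := fun x => Metric.ball x (r x)) fun x hx =>
      mem_nhdsWithin_of_mem_nhds (Metric.ball_mem_nhds x (hr x hx))
  refine ae_restrict_of_ae_restrict_of_subset hcover ?_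
  rw [ae_restrict_biUnion_iff _ ht]
  exact fun x hx => hp x (htΩ hx)

/-- `L²(Ω)³ⁿ` as a Hilbert space: the jets of `n`-tuples of functions. -/
abbrev JetTupleSpace (n : ℕ) (Ω : Set Plane) : Type :=
  PiLp 2 fun _ : Fin n × Option (Fin 2) => L2Space Ω

instance separableSpace_jetTupleSpace (n : ℕ) (Ω : Set Plane) :
    TopologicalSpace.SeparableSpace (JetTupleSpace n Ω) := by
  have : Fact ((2 : ENNReal) ≠ ⊤) := ⟨by simp⟩
  exact (WithLp.toLp_surjective 2).denseRange.separableSpace (PiLp.continuous_toLp 2 _)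

/-- The jet of the `j`-th function of a tuple. -/
noncomputable def jetTupleProj {n : ℕ} (Ω : Set Plane) (j : Fin n) :
    JetTupleSpace n Ω →L[ℝ] JetSpace Ω :=
  ContinuousLinearMap.pi fun o => PiLp.proj 2 (fun _ => L2Space Ω) (j, o)

/-- The gradient of a tuple of functions. -/
noncomputable def jetTupleGrad (n : ℕ) (Ω : Set Plane) :
    JetTupleSpace n Ω →L[ℝ] PiLp 2 fun _ : Fin n × Fin 2 => L2Space Ω :=
  (PiLp.continuousLinearEquiv 2 ℝ fun _ : Fin n × Fin 2 => L2Space Ω).symm.toContinuousLinearMap.comp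
    (ContinuousLinearMap.pi fun p => PiLp.proj 2 (fun _ => L2Space Ω) (p.1, some p.2))

theorem norm_sq_jetTupleGrad {n : ℕ} {Ω : Set Plane} (X : JetTupleSpace n Ω) :
    ‖jetTupleGrad n Ω X‖ ^ 2 = ∑ j, ∑ i, ‖jetTupleProj Ω j X (some i)‖ ^ 2 := by
  rw [PiLp.norm_sq_eq_of_L2, Fintype.sum_prod_type]
  rfl

theorem norm_sq_jetTuple {n : ℕ} {Ω : Set Plane} (X : JetTupleSpace n Ω) :
    ‖X‖ ^ 2 = ∑ j, ‖jetTupleProj Ω j X none‖ ^ 2 + ‖jetTupleGrad n Ω X‖ ^ 2 := by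
  rw [norm_sq_jetTupleGrad, PiLp.norm_sq_eq_of_L2, Fintype.sum_prod_type,
    ← Finset.sum_add_distrib]
  refine Finset.sum_congr rfl fun j _ => ?_
  rw [Fintype.sum_option]
  rfl

/-- The constraint class is weakly sequentially closed: a weak limit of jets of its members, along
which the jets are bounded, is the jet of a member. -/
theorem mem_constraintClass_of_weakTendsto {n : ℕ} {Ω : Set Plane} (hΩ : IsOpen Ω)
    (hb : Bornology.IsBounded Ω) {g : Fin n → frontier Ω → Circle} (hg : ∀ j, Continuous (g j))
    {u : ℕ → Fin n → Plane → ℂ} (hu : ∀ m, u m ∈ constraintClass g)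
    {U : ℕ → Fin n → JetSpace Ω}
    (hU : ∀ m j o, U m j o =ᵐ[volume.restrict Ω] weakJet Ω (u m j) o)
    {C : ℝ} (hC : ∀ m j, ‖U m j‖ ≤ C) {V : Fin n → JetSpace Ω}
    (hV : ∀ j, WeakTendsto (fun m => U m j) (V j)) :
    (fun j => (V j none : Plane → ℂ)) ∈ constraintClass g ∧
      ∀ j o, V j o =ᵐ[volume.restrict Ω] weakJet Ω (V j none) o := by
  have hUmem : ∀ m j (ε : ENNReal), 0 < ε → U m j ∈ closure (smoothJetsNear (g j) ε) :=
    fun m j ε hε => mem_closure_smoothJetsNear_of_hasTrace hΩ hb ((hu m).1 j).2 (hU m j) hε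
  have hVmem : ∀ j (ε : ENNReal), 0 < ε → V j ∈ closure (smoothJetsNear (g j) ε) := by
    intro j ε hε
    have := (hV j).mem_closure_of_convex (convex_smoothJetsNear (hg j) ε).closure
      (Eventually.of_forall fun m => hUmem m j ε hε)
    rwa [closure_closure] at this
  have hV1 := fun j => mem_H1WithBoundary_of_mem_closure hΩ hb (hVmem j)
  refine ⟨⟨fun j => (hV1 j).1, ?_⟩, fun j => (hV1 j).2⟩
  refine ae_restrict_of_forall_ball fun x hx => ?_
  obtain ⟨s, hs, hsΩ⟩ := Metric.isOpen_iff.1 hΩ x hx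
  refine ⟨s / 2, by positivity, ?_⟩
  have hball : Metric.ball x (s / 2 + s / 2) ⊆ Ω := by rwa [add_halves]
  have hμ : volume.restrict (Metric.ball x (s / 2)) ≤ volume.restrict Ω :=
    Measure.restrict_mono ((Metric.ball_subset_ball (by linarith)).trans hsΩ) le_rfl
  have hclosure : ∀ {j ε}, closure (smoothJetsNear (g j) ε) ⊆
      ((smoothJets Ω).topologicalClosure : Set (JetSpace Ω)) := fun {j ε} =>
    closure_mono (smoothJetsNear_subset (g j) ε)
  refine ae_sum_norm_sq_eq_of_tendsto (v := fun m j => U m j none)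
    (fun j => (Lp.aestronglyMeasurable _).mono_measure hμ)
    (fun m j => (Lp.aestronglyMeasurable _).mono_measure hμ) (fun m => ?_) fun j => ?_
  · have h1 : ∀ᵐ y ∂(volume.restrict Ω), ∀ j, U m j none y = u m j y :=
      ae_all_iff.2 fun j => hU m j none
    refine ae_mono hμ ?_
    filter_upwards [h1, (hu m).2] with y hy hy'
    simp only [hy, hy']
  · have hlim := tendsto_eLpNorm_ball_of_weakTendsto hΩ (V := fun m => U m j - V j)
      (fun m => (smoothJets Ω).topologicalClosure.sub_mem (hclosure (hUmem m j 1 one_pos))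
        (hclosure (hVmem j 1 one_pos)))
      (by simpa using (hV j).sub (tendsto_const_nhds (x := V j)).weakTendsto)
      (C := C + ‖V j‖) (fun m => (norm_sub_le _ _).trans (by linarith [hC m j]))
      (half_pos hs) hball
    refine hlim.congr fun m => eLpNorm_congr_ae (ae_mono hμ ?_)
    exact Lp.coeFn_sub (U m j none) (V j none)

/-- The direct method: if the constraint class is nonempty, then the infimum of the energy over it
is attained. -/
theorem exists_dirichletEnergy_le_minEnergy {n : ℕ} {Ω : Set Plane} (hΩ : IsOpen Ω)
    (hb : Bornology.IsBounded Ω) {g : Fin n → frontier Ω → Circle} (hg : ∀ j, Continuous (g j))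
    (hne : (constraintClass g).Nonempty) :
    ∃ u ∈ constraintClass g, dirichletEnergy Ω u ≤ minEnergy g := by
  have hbdd : BddBelow (dirichletEnergy Ω '' constraintClass g) :=
    ⟨0, by rintro _ ⟨u, -, rfl⟩; exact dirichletEnergy_nonneg Ω u⟩
  obtain ⟨e, -, he, heX⟩ := exists_seq_tendsto_sInf (hne.image (dirichletEnergy Ω)) hbdd
  choose u hu hue using heX
  have hmem := fun m j => ((hu m).1 j).1.memLp_weakJet hΩ
  set X : ℕ → JetTupleSpace n Ω := fun m => WithLp.toLp 2 fun p => (hmem m p.1 p.2).toLp with hX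
  have hXU : ∀ m j o, jetTupleProj Ω j (X m) o =ᵐ[volume.restrict Ω] weakJet Ω (u m j) o :=
    fun m j o => (hmem m j o).coeFn_toLp
  have hgrad : ∀ m, ‖jetTupleGrad n Ω (X m)‖ ^ 2 = e m := fun m => by
    rw [norm_sq_jetTupleGrad, ← hue m, dirichletEnergy_eq_sum_norm_sq (hXU m)]
  obtain ⟨B, hB⟩ := he.bddAbove_range
  have hXb : ∀ m, ‖X m‖ ≤ √(volume.real Ω * n + B) := by
    intro m
    refine Real.le_sqrt_of_sq_le ?_
    rw [norm_sq_jetTuple, hgrad, sum_norm_sq_eq_of_constraint (fun j => hXU m j none) (hu m).2]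
    linarith [hB ⟨m, rfl⟩]
  obtain ⟨Y, σ, hσ, hY⟩ := exists_weakTendsto_subseq hXb
  obtain ⟨hYX, hYjet⟩ := mem_constraintClass_of_weakTendsto hΩ hb hg (fun m => hu (σ m))
    (U := fun m j => jetTupleProj Ω j (X (σ m))) (fun m j o => hXU (σ m) j o)
    (C := √(volume.real Ω * n + B))
    (fun m j => (pi_norm_le_iff_of_nonneg (Real.sqrt_nonneg _)).2 fun o =>
      (PiLp.norm_apply_le (X (σ m)) (j, o)).trans (hXb (σ m)))
    (V := fun j => jetTupleProj Ω j Y) (fun j => hY.map (jetTupleProj Ω j))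
  refine ⟨_, hYX, ?_⟩
  have hnorm : Tendsto (fun m => ‖jetTupleGrad n Ω (X (σ m))‖) atTop (𝓝 √(minEnergy g)) := by
    refine ((he.comp hσ.tendsto_atTop).sqrt).congr fun m => ?_
    rw [Function.comp_apply, ← hgrad, Real.sqrt_sq (norm_nonneg _)]
  have hle := (hY.map (jetTupleGrad n Ω)).norm_le_of_tendsto hnorm
  have h0 : 0 ≤ minEnergy g := Real.sInf_nonneg (by
    rintro _ ⟨v, -, rfl⟩
    exact dirichletEnergy_nonneg Ω v)
  rw [dirichletEnergy_eq_sum_norm_sq hYjet, ← norm_sq_jetTupleGrad]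
  exact (Real.le_sqrt (norm_nonneg _) h0).1 hle

theorem mainTheorem2 (Ω : Set Plane) (hΩ : IsSmoothSimplyConnectedDomain Ω)
    (n : ℕ) (hn : 2 ≤ n)
    (g : Fin n → frontier Ω → Circle) (hg : ∀ j, IsSmoothBoundaryMap (g j))
    (d : Fin n → ℤ) (hdeg : ∀ j, HasBoundaryDegree (g j) (d j)) (hd : ∀ j, 0 ≤ d j) :
    (constraintClass g).Nonempty ∧
      ∃ u ∈ constraintClass g, dirichletEnergy Ω u = minEnergy g ∧
        ∀ v ∈ constraintClass g, dirichletEnergy Ω u ≤ dirichletEnergy Ω v := by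
  have hne := constraintClass_nonempty hΩ.isOpen hΩ.bounded hn hg
  have hmin : ∀ v ∈ constraintClass g, minEnergy g ≤ dirichletEnergy Ω v := fun v hv =>
    csInf_le ⟨0, by rintro _ ⟨w, -, rfl⟩; exact dirichletEnergy_nonneg Ω w⟩ ⟨v, hv, rfl⟩
  obtain ⟨u, hu, hle⟩ := exists_dirichletEnergy_le_minEnergy hΩ.isOpen hΩ.bounded
    (fun j => (hg j).continuous) hne
  exact ⟨hne, u, hu, le_antisymm hle (hmin u hu), fun v hv => hle.trans (hmin v hv)⟩
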